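/- Let $p_1$ be an odd prime, let $p\neq p_1$ be a prime, and let $k$ be the order of $p$ in the multiplicative group $(\mathbb Z/(p_1))^*$. Put $\nu(k)=1$ if $k$ is even and $\nu(k)=2$ if $k$ is odd. For a bilinear form $b$ on a $\mathbb Z/(p)$-vector space $V$, let $\mathrm O(V,b)$ be the group of all automorphisms $f$ of $V$ with $b(f(x),f(y))=b(x,y)$ for all $x,y\in V$. Consider the triples $(V,b,f)$, where $V$ is a finite-dimensional $\mathbb Z/(p)$-vector space, $b$ is a non-singular symmetric bilinear form on $V$, and $f\in \mathrm O(V,b)$ is an element of order $p_1$ such that $f-\mathrm{id}$ is bijective. Then the minimal dimension of $V$ in such a triple is $\nu(k)k$ (in particular this dimension is attained). Furthermore, for every such triple $(V,b,f)$ with $\dim V=\nu(k)k$: (i) if $p$ and $k$ are odd, then $V$ has a totally isotropic subspace of dimension $k$, and $\mathrm O(V,b)\cong GO^+_{2k}(p)$; (ii) if $p$ is odd and $k$ is even, then $V$ has no totally isotropic subspace of dimension $k/2$, and $\mathrm O(V,b)\cong GO^-_{k}(p)$; (iii) if $p=2$ and $k$ is odd, then $b$ is alternating, and $\mathrm O(V,b)\cong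 \mathrm{Sp}_{2k}(2)$; (iv) if $p=2$ and $k$ is even, then $b$ is alternating, and $\mathrm O(V,b)\cong \mathrm{Sp}_{k}(2)$. Here, for an odd prime $p$ and $m\ge 1$, $GO^+_{2m}(p)$ denotes the orthogonal group of the orthogonal sum of $m$ hyperbolic planes over $\mathbb Z/(p)$ (the non-singular symmetric form on a $2m$-dimensional space that has a totally isotropic subspace of dimension $m$), $GO^-_{2m}(p)$ denotes the orthogonal group of the orthogonal sum of $m-1$ hyperbolic planes and the anisotropic plane with quadratic form $x^2-dy^2$, where $d$ is a non-square (the non-singular symmetric form on a $2m$-dimensional space that has no totally isotropic subspace of dimension $m$), and $\mathrm{Sp}_{2m}(2)$ denotes the symplectic group of $2m\times 2m$ matrices over $\mathbb Z/(2)$. -/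

import Mathlib

universe u

/-- The orthogonal group `O(V, b)`: the linear automorphisms of `V` that preserve `b`.
Over `ZMod p` every additive automorphism is linear. -/
def orthogonalGroup {K V : Type*} [CommRing K] [AddCommGroup V] [Module K V]
    (b : LinearMap.BilinForm K V) : Subgroup (V ≃ₗ[K] V) where
  carrier := {f | ∀ x y, b (f x) (f y) = b x y}
  mul_mem' := by
    intro f g hf hg x y
    rw [LinearEquiv.mul_apply, LinearEquiv.mul_apply, hf, hg]
  one_mem' := by
    intro x y
    rfl
  inv_mem' := by
    intro f hf x y
    have h := hf (f⁻¹ x) (f⁻¹ y)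
    rw [← LinearEquiv.mul_apply, ← LinearEquiv.mul_apply, mul_inv_cancel] at h
    exact h.symm

/-- `b` is a non-singular symmetric bilinear form on `V`, and `f ∈ O(V, b)` has order `q` and
`f - id` is bijective. -/
structure IsOrthogonalPair {K V : Type*} [CommRing K] [AddCommGroup V] [Module K V]
    (q : ℕ) (b : LinearMap.BilinForm K V) (f : V ≃ₗ[K] V) : Prop where
  symm : b.IsSymm
  nondegenerate : b.Nondegenerate
  mem : f ∈ orthogonalGroup b
  order : orderOf f = q
  bijective : Function.Bijective (fun v : V => f v - v)

/-- `V` has an `m`-dimensional totally isotropic subspace with respect to `b`. -/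
def HasTotallyIsotropic {K V : Type*} [Field K] [AddCommGroup V] [Module K V]
    (b : LinearMap.BilinForm K V) (m : ℕ) : Prop :=
  ∃ W : Submodule K V, Module.finrank K W = m ∧ ∀ x ∈ W, ∀ y ∈ W, b x y = 0

/-- Gram matrix of the orthogonal sum of `m` hyperbolic planes. -/
def gramPlus (m p : ℕ) : Matrix (Fin m ⊕ Fin m) (Fin m ⊕ Fin m) (ZMod p) :=
  Matrix.fromBlocks 0 1 1 0

/-- The group `GO⁺_{2m}(p)` for an odd prime `p`. -/
def GOPlus (m p : ℕ) :
    Subgroup ((Fin m ⊕ Fin m → ZMod p) ≃ₗ[ZMod p] (Fin m ⊕ Fin m → ZMod p)) :=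
  orthogonalGroup (Matrix.toBilin' (gramPlus m p))

/-- A non-square of `ZMod p`, for an odd prime `p`. -/
noncomputable def nonsquare (p : ℕ) : ZMod p :=
  Classical.epsilon fun d => ¬ IsSquare d

theorem nonsquare_spec {p : ℕ} [Fact p.Prime] (hp : p ≠ 2) : ¬ IsSquare (nonsquare p) :=
  Classical.epsilon_spec (p := fun d : ZMod p => ¬ IsSquare d)
    (FiniteField.exists_nonsquare (by rw [ZMod.ringChar_zmod_n]; exact hp))

/-- Gram matrix of the orthogonal sum of `m - 1` hyperbolic planes and the anisotropic plane with
quadratic form `x ^ 2 - d * y ^ 2`, where `d` is a non-square (for `1 ≤ m`, of size `2 * m`). -/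
noncomputable def gramMinus (m p : ℕ) :
    Matrix ((Fin (m - 1) ⊕ Fin (m - 1)) ⊕ Fin 2) ((Fin (m - 1) ⊕ Fin (m - 1)) ⊕ Fin 2) (ZMod p) :=
  Matrix.fromBlocks (gramPlus (m - 1) p) 0 0 (Matrix.diagonal ![1, -nonsquare p])

/-- The group `GO⁻_{2m}(p)` for an odd prime `p` and `1 ≤ m`. -/
noncomputable def GOMinus (m p : ℕ) :
    Subgroup (((Fin (m - 1) ⊕ Fin (m - 1)) ⊕ Fin 2 → ZMod p) ≃ₗ[ZMod p]
      ((Fin (m - 1) ⊕ Fin (m - 1)) ⊕ Fin 2 → ZMod p)) :=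
  orthogonalGroup (Matrix.toBilin' (gramMinus m p))

/-- `ν(k) = 1` if `k` is even and `ν(k) = 2` if `k` is odd. -/
def nu (k : ℕ) : ℕ := if Even k then 1 else 2

/-! Write `q` for the odd prime order of `f`. Since `f` fixes only `0`, it acts freely on the
non-zero vectors of every invariant subspace `W`, so `p ^ dim W ≡ 1` modulo `q` and `k ∣ dim W`
(`cast_pow_finrank_eq_one`). Also `dim V` is even (`even_finrank_of_isometry`): the form `b x (f y)
- b (f x) y` is alternating, and non-singular because `f ^ 2` has no fixed vector either. So `lcm(2,
k) = ν(k)k` divides `dim V`. The bound is attained by multiplication by a `q`-th root of unity `ζ`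
on the field of `p ^ k` elements with a twisted trace form (`k` even), or by `(ζ, ζ⁻¹)` on two
copies of it paired by the trace (`k` odd).

In the minimal dimension the form is determined. For `k` odd, an invariant `W` of dimension `k`
exists and is irreducible, so `W ⊓ Wᗮ` is `0` or `W`; the value `0` would give a non-singular form
in odd dimension with an isometry of the excluded kind, hence `W` is totally isotropic. For `p` odd
and `k = 2m`, the isotropic vectors form an invariant set, so their number is `1` modulo `q`; the
count for `m` hyperbolic planes violates this because `p ^ m = -1` modulo `q`. For `p = 2`,
surjectivity of `f - 1` forces `b` to be alternating. In each case splitting off hyperbolic planes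
yields a standard Gram matrix, and equal Gram matrices give isomorphic groups. -/

/-! ### Hyperbolic pairs and their orthogonal complements. -/

section hyperbolic

open Module LinearMap LinearMap.BilinForm

variable {K V : Type*} [Field K] [AddCommGroup V] [Module K V] {b : LinearMap.BilinForm K V}

/-- The orthogonal complement of the pair `e, f`. -/
def pairOrthogonal (b : LinearMap.BilinForm K V) (e f : V) : Submodule K V :=
  b.orthogonal (Submodule.span K {e, f})

theorem mem_pairOrthogonal {e f x : V} : x ∈ pairOrthogonal b e f ↔ b e x = 0 ∧ b f x = 0 := by
  constructor
  · intro h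
    exact ⟨h e (Submodule.subset_span (by simp)), h f (Submodule.subset_span (by simp))⟩
  · rintro ⟨he, hf⟩ y hy
    obtain ⟨s, t, rfl⟩ := Submodule.mem_span_pair.1 hy
    simp [he, hf]

theorem disjoint_span_pair_pairOrthogonal (hr : b.IsRefl) {e f : V} (he : b e e = 0)
    (hf : b f f = 0) (hef : b e f = 1) :
    Disjoint (Submodule.span K {e, f}) (pairOrthogonal b e f) := by
  rw [Submodule.disjoint_def]
  intro x hx hx'
  obtain ⟨s, t, rfl⟩ := Submodule.mem_span_pair.1 hx
  obtain ⟨h1, h2⟩ := mem_pairOrthogonal.1 hx'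
  have hfe : b f e ≠ 0 := fun h => by simp [hr f e h] at hef
  have ht : t = 0 := by simpa [he, hef] using h1
  have hs : s = 0 := by simpa [hf, hfe] using h2
  simp [ht, hs]

theorem finrank_span_hyperbolic_pair (hr : b.IsRefl) {e f : V} (he : b e e = 0)
    (hf : b f f = 0) (hef : b e f = 1) : finrank K (Submodule.span K {e, f}) = 2 := by
  have hfe : b f e ≠ 0 := fun h => by simp [hr f e h] at hef
  have hli : LinearIndependent K ![e, f] := by
    rw [LinearIndependent.pair_iff]
    intro s t h
    have h1 := congrArg (b e) h
    have h2 := congrArg (b f) h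
    simp [he, hef, hf, hfe] at h1 h2
    exact ⟨h2, h1⟩
  have := finrank_span_eq_card hli
  rwa [Matrix.range_cons, Matrix.range_cons, Matrix.range_empty, Set.union_empty,
    Set.singleton_union, Fintype.card_fin] at this

theorem exists_apply_eq_one (hb : b.Nondegenerate) {e : V} (he : e ≠ 0) : ∃ f, b e f = 1 := by
  by_contra! h
  refine he (hb.1 e fun y => ?_)
  by_contra hy
  exact h ((b e y)⁻¹ • y) (by simp [hy])

/-- An isotropic vector is part of a hyperbolic pair, in characteristic other than two. -/
theorem exists_hyperbolic_pair (h2 : (2 : K) ≠ 0) (hs : b.IsSymm) (hb : b.Nondegenerate) {e : V}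
    (he : e ≠ 0) (hee : b e e = 0) : ∃ f, b f f = 0 ∧ b e f = 1 := by
  obtain ⟨f, hf⟩ := exists_apply_eq_one hb he
  have hf' : b f e = 1 := by rw [← hf]; exact hs.eq f e
  -- Moving `f` along `e` changes `b f f` by twice the coefficient and leaves `b e f` alone.
  refine ⟨f - (b f f / 2) • e, ?_, by simp [hee, hf]⟩
  simp [hee, hf, hf']
  field_simp
  ring

variable [FiniteDimensional K V]

theorem finrank_pairOrthogonal (hr : b.IsRefl) (hb : b.Nondegenerate) {e f : V} (he : b e e = 0)
    (hf : b f f = 0) (hef : b e f = 1) : finrank K (pairOrthogonal b e f) + 2 = finrank K V := by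
  have h1 := finrank_span_hyperbolic_pair hr he hf hef
  have h2 := (Submodule.span K {e, f}).finrank_le
  have h3 := LinearMap.BilinForm.finrank_orthogonal hb (Submodule.span K {e, f})
  unfold pairOrthogonal
  omega

theorem nondegenerate_restrict_pairOrthogonal (hr : b.IsRefl) (hb : b.Nondegenerate) {e f : V}
    (he : b e e = 0) (hf : b f f = 0) (hef : b e f = 1) :
    (b.restrict (pairOrthogonal b e f)).Nondegenerate := by
  rw [LinearMap.BilinForm.restrict_nondegenerate_iff_isCompl_orthogonal hr, pairOrthogonal,
    LinearMap.BilinForm.orthogonal_orthogonal hb hr]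
  exact ((LinearMap.BilinForm.isCompl_orthogonal_iff_disjoint hr).2
    (disjoint_span_pair_pairOrthogonal hr he hf hef)).symm

/-- Any non-zero vector of an alternating space lies in a hyperbolic pair, in every characteristic;
the complement of the pair has dimension two less. The space is quantified after `n` so that the
induction can pass to this complement. -/
theorem even_finrank_of_isAlt (n : ℕ) : ∀ {V : Type*} [AddCommGroup V] [Module K V]
    [FiniteDimensional K V] {b : LinearMap.BilinForm K V}, b.IsAlt → b.Nondegenerate →
    finrank K V = n → Even n := by
  induction n using Nat.strong_induction_on with
  | _ n ih =>
    intro V _ _ _ b ha hb hn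
    rcases Nat.eq_zero_or_pos n with rfl | hpos
    · exact Even.zero
    have : Nontrivial V := Module.nontrivial_of_finrank_pos (R := K) (by omega)
    obtain ⟨e, he⟩ := exists_ne (0 : V)
    obtain ⟨f, hf⟩ := exists_apply_eq_one hb he
    have h1 := finrank_pairOrthogonal ha.isRefl hb (ha e) (ha f) hf
    have h2 := ih (finrank K (pairOrthogonal b e f)) (by omega)
      (b := b.restrict (pairOrthogonal b e f)) (fun x => ha x)
      (nondegenerate_restrict_pairOrthogonal ha.isRefl hb (ha e) (ha f) hf) rfl
    rw [← hn, ← h1]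
    exact h2.add even_two

end hyperbolic

/-! ### Gram matrices of sums of hyperbolic planes. -/

section gram

open Module

variable {p : ℕ} [Fact p.Prime]

theorem ZMod.two_ne_zero_of_ne_two (hp : p ≠ 2) : (2 : ZMod p) ≠ 0 :=
  Ring.two_ne_zero (by rwa [ZMod.ringChar_zmod_n])

/-- The second conclusion keeps the new family orthogonal to the anisotropic plane when
`exists_gramMinus` adds a hyperbolic pair. -/
theorem exists_gramPlus_succ {V : Type*} [AddCommGroup V] [Module (ZMod p) V]
    {b : LinearMap.BilinForm (ZMod p) V} (hs : b.IsSymm) {e f : V} (he : b e e = 0)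
    (hf : b f f = 0) (hef : b e f = 1) {m : ℕ} {v : Fin m ⊕ Fin m → pairOrthogonal b e f}
    (hv : ∀ i j, b (v i) (v j) = gramPlus m p i j) :
    ∃ w : Fin (m + 1) ⊕ Fin (m + 1) → V, (∀ i j, b (w i) (w j) = gramPlus (m + 1) p i j) ∧
      ∀ i x, b e x = 0 → b f x = 0 → (∀ j, b (v j) x = 0) → b (w i) x = 0 := by
  have hfe : b f e = 1 := by rw [← hef]; exact hs.eq f e
  have h1 : ∀ i, b e (v i) = 0 := fun i => (mem_pairOrthogonal.1 (v i).2).1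
  have h2 : ∀ i, b f (v i) = 0 := fun i => (mem_pairOrthogonal.1 (v i).2).2
  have h3 : ∀ i, b (v i) e = 0 := fun i => by rw [← h1 i]; exact hs.eq _ _
  have h4 : ∀ i, b (v i) f = 0 := fun i => by rw [← h2 i]; exact hs.eq _ _
  refine ⟨Sum.elim (Fin.cons e fun i => (v (Sum.inl i) : V))
    (Fin.cons f fun i => (v (Sum.inr i) : V)), ?_, ?_⟩
  · rintro (i | i) (j | j) <;> refine Fin.cases ?_ (fun i => ?_) i <;>
      refine Fin.cases ?_ (fun j => ?_) j <;>
      simp [gramPlus, Matrix.one_apply, he, hf, hef, hfe, h1, h2, h3, h4, hv, Fin.ext_iff]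
  · intro i x hx hx' hvx
    rcases i with i | i <;> refine Fin.cases ?_ (fun i => ?_) i <;> simp [hx, hx', hvx]

theorem exists_gramPlus_of_isAlt (m : ℕ) : ∀ {V : Type*} [AddCommGroup V] [Module (ZMod p) V]
    [FiniteDimensional (ZMod p) V] {b : LinearMap.BilinForm (ZMod p) V}, b.IsSymm → b.IsAlt →
    b.Nondegenerate → finrank (ZMod p) V = 2 * m →
    ∃ v : Fin m ⊕ Fin m → V, ∀ i j, b (v i) (v j) = gramPlus m p i j := by
  induction m with
  | zero =>
    intro V _ _ _ b _ _ _ _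
    exact ⟨fun _ => 0, fun i => by rcases i with i | i <;> exact i.elim0⟩
  | succ m ih =>
    intro V _ _ _ b hs ha hb hn
    have : Nontrivial V := Module.nontrivial_of_finrank_pos (R := ZMod p) (by omega)
    obtain ⟨e, he⟩ := exists_ne (0 : V)
    obtain ⟨f, hf⟩ := exists_apply_eq_one hb he
    have h1 := finrank_pairOrthogonal ha.isRefl hb (ha e) (ha f) hf
    obtain ⟨v, hv⟩ := ih (b := b.restrict (pairOrthogonal b e f)) ⟨fun x y => hs.eq x y⟩
      (fun x => ha x) (nondegenerate_restrict_pairOrthogonal ha.isRefl hb (ha e) (ha f) hf)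
      (by omega)
    obtain ⟨w, hw, -⟩ := exists_gramPlus_succ hs (ha e) (ha f) hf hv
    exact ⟨w, hw⟩

theorem exists_gramPlus_of_hasTotallyIsotropic (hp : p ≠ 2) (m : ℕ) : ∀ {V : Type*}
    [AddCommGroup V] [Module (ZMod p) V] [FiniteDimensional (ZMod p) V]
    {b : LinearMap.BilinForm (ZMod p) V}, b.IsSymm → b.Nondegenerate →
    finrank (ZMod p) V = 2 * m → HasTotallyIsotropic b m →
    ∃ v : Fin m ⊕ Fin m → V, ∀ i j, b (v i) (v j) = gramPlus m p i j := by
  induction m with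
  | zero =>
    intro V _ _ _ b _ _ _ _
    exact ⟨fun _ => 0, fun i => by rcases i with i | i <;> exact i.elim0⟩
  | succ m ih =>
    rintro V _ _ _ b hs hb hn ⟨W, hW, hiso⟩
    have hr : b.IsRefl := hs.isRefl
    have : Nontrivial W := Module.nontrivial_of_finrank_pos (R := ZMod p) (by omega)
    obtain ⟨⟨e, heW⟩, he⟩ := exists_ne (0 : W)
    have he : e ≠ 0 := fun h => he (by simpa using h)
    have hee := hiso e heW e heW
    obtain ⟨f, hf, hef⟩ := exists_hyperbolic_pair (ZMod.two_ne_zero_of_ne_two hp) hs hb he hee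
    have h1 := finrank_pairOrthogonal hr hb hee hf hef
    -- On `W` the functional `b e` vanishes, so the only condition left is `b f x = 0`; it is
    -- non-trivial at `e` and lowers the dimension by exactly one.
    have hker : finrank (ZMod p) (W ⊓ pairOrthogonal b e f : Submodule (ZMod p) V) = m := by
      have hmap : (W ⊓ pairOrthogonal b e f : Submodule (ZMod p) V) =
          (LinearMap.ker ((b f).domRestrict W)).map W.subtype := by
        ext x
        simp only [Submodule.mem_inf, mem_pairOrthogonal, Submodule.mem_map, LinearMap.mem_ker]
        constructor
        · rintro ⟨hx, -, hx'⟩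
          exact ⟨⟨x, hx⟩, hx', rfl⟩
        · rintro ⟨⟨x, hx⟩, hx', rfl⟩
          exact ⟨hx, hiso e heW x hx, hx'⟩
      have hne : (b f).domRestrict W ≠ 0 := fun h => by
        have h0 : b f e = 0 := LinearMap.congr_fun h ⟨e, heW⟩
        rw [hr f e h0] at hef
        exact zero_ne_one hef
      have h3 := LinearMap.finrank_range_add_finrank_ker ((b f).domRestrict W)
      rw [LinearMap.range_eq_top.2 (LinearMap.surjective hne), finrank_top, finrank_self] at h3
      rw [hmap, Submodule.finrank_map_subtype_eq]
      omega
    obtain ⟨v, hv⟩ := ih (b := b.restrict (pairOrthogonal b e f)) ⟨fun x y => hs.eq x y⟩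
      (nondegenerate_restrict_pairOrthogonal hr hb hee hf hef) (by omega)
      ⟨Submodule.comap (pairOrthogonal b e f).subtype W, by
        rw [← hker, inf_comm, ← Submodule.map_comap_subtype, Submodule.finrank_map_subtype_eq],
        fun x hx y hy => hiso x hx y hy⟩
    obtain ⟨w, hw, -⟩ := exists_gramPlus_succ hs hee hf hef hv
    exact ⟨w, hw⟩
end gram

/-! ### Forms over `ZMod p`, `p` odd, without a half-dimensional isotropic subspace. -/

section minus

open Module

variable {p : ℕ} [Fact p.Prime]

theorem ZMod.exists_mul_sq_add_mul_sq_eq {a c : ZMod p} (ha : a ≠ 0) (hc : c ≠ 0) (r : ZMod p)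
    (hp : p ≠ 2) : ∃ s t : ZMod p, a * s ^ 2 + c * t ^ 2 = r := by
  open Polynomial in
  obtain ⟨s, t, h⟩ := FiniteField.exists_root_sum_quadratic
    (f := C a * X ^ 2 + C 0 * X + C 0) (g := C c * X ^ 2 + C 0 * X + C (-r))
    (degree_quadratic ha) (degree_quadratic hc)
    (by rw [ZMod.card]; exact (Fact.out : p.Prime).eq_two_or_odd.resolve_left hp)
  refine ⟨s, t, ?_⟩
  simp at h
  linear_combination h

theorem exists_self_ne_zero_orthogonal {V : Type*} [AddCommGroup V] [Module (ZMod p) V]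
    [FiniteDimensional (ZMod p) V] {b : LinearMap.BilinForm (ZMod p) V} (hp : p ≠ 2)
    (hs : b.IsSymm) (hb : b.Nondegenerate) (hn : 0 < finrank (ZMod p) V) : ∃ x, b x x ≠ 0 := by
  have : Nontrivial V := Module.nontrivial_of_finrank_pos hn
  have : Invertible (2 : ZMod p) := invertibleOfNonzero (ZMod.two_ne_zero_of_ne_two hp)
  exact LinearMap.BilinForm.exists_bilinForm_self_ne_zero hb.ne_zero
    (LinearMap.BilinForm.isSymm_iff.1 hs)

theorem finrank_orthogonal_span_singleton_add_one {V : Type*} [AddCommGroup V] [Module (ZMod p) V]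
    [FiniteDimensional (ZMod p) V] {b : LinearMap.BilinForm (ZMod p) V}
    (hb : b.Nondegenerate) {x : V} (hx : x ≠ 0) :
    finrank (ZMod p) (b.orthogonal (Submodule.span (ZMod p) {x})) + 1 = finrank (ZMod p) V := by
  have h := LinearMap.BilinForm.finrank_orthogonal hb (Submodule.span (ZMod p) {x})
  have h' := (Submodule.span (ZMod p) {x}).finrank_le
  rw [finrank_span_singleton hx] at h h'
  omega

/-- A non-singular form of dimension at least two over a finite field of odd characteristic
represents every scalar. -/
theorem exists_self_eq {V : Type*} [AddCommGroup V] [Module (ZMod p) V]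
    [FiniteDimensional (ZMod p) V] {b : LinearMap.BilinForm (ZMod p) V} (hp : p ≠ 2)
    (hs : b.IsSymm) (hb : b.Nondegenerate) (hn : 2 ≤ finrank (ZMod p) V) (r : ZMod p) :
    ∃ x, b x x = r := by
  obtain ⟨x, hx⟩ := exists_self_ne_zero_orthogonal hp hs hb (by omega)
  have hx0 : x ≠ 0 := fun h => hx (by simp [h])
  have h1 := finrank_orthogonal_span_singleton_add_one hb hx0
  obtain ⟨⟨y, hy⟩, hyy⟩ := exists_self_ne_zero_orthogonal hp (hs.restrict _)
    (LinearMap.BilinForm.restrict_nondegenerate_orthogonal_spanSingleton b hb hs.isRefl hx)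
    (by omega)
  have hxy : b x y = 0 := hy x (Submodule.mem_span_singleton_self x)
  have hyx : b y x = 0 := hs.isRefl _ _ hxy
  obtain ⟨s, t, h⟩ := ZMod.exists_mul_sq_add_mul_sq_eq hx hyy r hp
  refine ⟨s • x + t • y, ?_⟩
  simp at h
  simp [hxy, hyx]
  linear_combination h

/-- The complement of an anisotropic `x` has dimension at least two, so it represents `-b x x`. -/
theorem exists_isotropic {V : Type*} [AddCommGroup V] [Module (ZMod p) V]
    [FiniteDimensional (ZMod p) V] {b : LinearMap.BilinForm (ZMod p) V} (hp : p ≠ 2)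
    (hs : b.IsSymm) (hb : b.Nondegenerate) (hn : 3 ≤ finrank (ZMod p) V) :
    ∃ x, x ≠ 0 ∧ b x x = 0 := by
  obtain ⟨x, hx⟩ := exists_self_ne_zero_orthogonal hp hs hb (by omega)
  have hx0 : x ≠ 0 := fun h => hx (by simp [h])
  have h1 := finrank_orthogonal_span_singleton_add_one hb hx0
  obtain ⟨⟨y, hy⟩, hyy⟩ := exists_self_eq hp (hs.restrict _)
    (LinearMap.BilinForm.restrict_nondegenerate_orthogonal_spanSingleton b hb hs.isRefl hx)
    (by omega) (-b x x)
  have hxy : b x y = 0 := hy x (Submodule.mem_span_singleton_self x)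
  have hyx : b y x = 0 := hs.isRefl _ _ hxy
  simp at hyy
  refine ⟨x + y, fun h => hx ?_, by simp [hxy, hyx, hyy]⟩
  have := congrArg (b x) h
  simpa [hxy] using this

theorem hasTotallyIsotropic_one {K V : Type*} [Field K] [AddCommGroup V] [Module K V]
    {b : LinearMap.BilinForm K V} {x : V} (hx : x ≠ 0) (hxx : b x x = 0) :
    HasTotallyIsotropic b 1 := by
  refine ⟨Submodule.span K {x}, finrank_span_singleton hx, fun y hy z hz => ?_⟩
  obtain ⟨s, rfl⟩ := Submodule.mem_span_singleton.1 hy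
  obtain ⟨t, rfl⟩ := Submodule.mem_span_singleton.1 hz
  simp [hxx]

theorem HasTotallyIsotropic.succ {K V : Type*} [Field K] [AddCommGroup V] [Module K V]
    [FiniteDimensional K V] {b : LinearMap.BilinForm K V} (hr : b.IsRefl) {e f : V}
    (hee : b e e = 0) (hef : b e f = 1) {m : ℕ}
    (h : HasTotallyIsotropic (b.restrict (pairOrthogonal b e f)) m) :
    HasTotallyIsotropic b (m + 1) := by
  obtain ⟨U, hU, hiso⟩ := h
  have he : e ≠ 0 := fun h => by simp [h] at hef
  have hfe : b f e ≠ 0 := fun h => by simp [hr f e h] at hef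
  have hUe : ∀ u : pairOrthogonal b e f, b e u = 0 := fun u => (mem_pairOrthogonal.1 u.2).1
  have hUe' : ∀ u : pairOrthogonal b e f, b u e = 0 := fun u => hr _ _ (hUe u)
  have hUf : ∀ u : pairOrthogonal b e f, b f u = 0 := fun u => (mem_pairOrthogonal.1 u.2).2
  refine ⟨Submodule.span K {e} ⊔ U.map (pairOrthogonal b e f).subtype, ?_, ?_⟩
  · have h1 := Submodule.finrank_sup_add_finrank_inf_eq (Submodule.span K {e})
      (U.map (pairOrthogonal b e f).subtype)
    have h2 : Submodule.span K {e} ⊓ U.map (pairOrthogonal b e f).subtype = ⊥ := by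
      rw [Submodule.eq_bot_iff]
      rintro x ⟨hx, u, hu, rfl⟩
      obtain ⟨s, hs⟩ := Submodule.mem_span_singleton.1 hx
      have h3 := congrArg (b f) hs
      rw [Submodule.subtype_apply, hUf] at h3
      have : s = 0 := by simpa [hfe] using h3
      rw [← hs, this, zero_smul]
    rw [h2, finrank_bot, finrank_span_singleton he, Submodule.finrank_map_subtype_eq, hU] at h1
    omega
  · intro x hx y hy
    obtain ⟨x₁, hx₁, x₂, ⟨x₂, hx₂, rfl⟩, rfl⟩ := Submodule.mem_sup.1 hx
    obtain ⟨y₁, hy₁, y₂, ⟨y₂, hy₂, rfl⟩, rfl⟩ := Submodule.mem_sup.1 hy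
    obtain ⟨s, rfl⟩ := Submodule.mem_span_singleton.1 hx₁
    obtain ⟨t, rfl⟩ := Submodule.mem_span_singleton.1 hy₁
    have := hiso x₂ hx₂ y₂ hy₂
    simp at this
    simp [hee, hUe, hUe', this]

theorem ZMod.isSquare_mul_of_not_isSquare (hp : p ≠ 2) {c d : ZMod p} (hc : ¬ IsSquare c)
    (hd : ¬ IsSquare d) : IsSquare (c * d) := by
  have hc0 : c ≠ 0 := fun h => hc (h ▸ IsSquare.zero)
  have hd0 : d ≠ 0 := fun h => hd (h ▸ IsSquare.zero)
  have hch : ringChar (ZMod p) ≠ 2 := by rwa [ZMod.ringChar_zmod_n]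
  rw [← quadraticChar_one_iff_isSquare (mul_ne_zero hc0 hd0), map_mul,
    quadraticChar_neg_one_iff_not_isSquare.2 hc, quadraticChar_neg_one_iff_not_isSquare.2 hd]
  norm_num

/-- Hyperbolic planes are split off until a plane remains. It is still anisotropic, since an
isotropic subspace of the complement grows by `e` (`HasTotallyIsotropic.succ`). -/
theorem exists_gramMinus (hp : p ≠ 2) (m : ℕ) : ∀ {V : Type*}
    [AddCommGroup V] [Module (ZMod p) V] [FiniteDimensional (ZMod p) V]
    {b : LinearMap.BilinForm (ZMod p) V}, b.IsSymm → b.Nondegenerate →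
    finrank (ZMod p) V = 2 * (m + 1) → ¬ HasTotallyIsotropic b (m + 1) →
    ∃ v : (Fin m ⊕ Fin m) ⊕ Fin 2 → V, ∀ i j, b (v i) (v j) = gramMinus (m + 1) p i j := by
  induction m with
  | zero =>
    intro V _ _ _ b hs hb hn hiso
    obtain ⟨x, hx⟩ := exists_self_eq hp hs hb (by omega) 1
    have hx0 : x ≠ 0 := fun h => by simp [h] at hx
    have h1 := finrank_orthogonal_span_singleton_add_one hb hx0
    obtain ⟨⟨y, hy⟩, hyy⟩ := exists_self_ne_zero_orthogonal hp (hs.restrict _)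
      (LinearMap.BilinForm.restrict_nondegenerate_orthogonal_spanSingleton b hb hs.isRefl
        (hx ▸ one_ne_zero)) (by omega)
    have hxy : b x y = 0 := hy x (Submodule.mem_span_singleton_self x)
    have hyx : b y x = 0 := hs.isRefl _ _ hxy
    simp at hyy
    -- If `-b y y = s * s`, then `s • x + y` is isotropic.
    have hsq : ¬ IsSquare (-b y y) := by
      rintro ⟨s, hs'⟩
      refine hiso (hasTotallyIsotropic_one (x := s • x + y) (fun h => ?_) ?_)
      · have := congrArg (b y) h
        simp [hyx, hyy] at this
      · simp [hxy, hyx, hx]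
        linear_combination -hs'
    have hd := nonsquare_spec hp
    obtain ⟨r, hr⟩ := ZMod.isSquare_mul_of_not_isSquare hp hsq hd
    have hr0 : r ≠ 0 := by
      rintro rfl
      have : nonsquare p ≠ 0 := fun h => hd (h ▸ IsSquare.zero)
      simp [hyy, this] at hr
    -- From `-b y y * d = r * r` with `d` the chosen non-square, scaling `y` by `d / r` makes its
    -- self-pairing `-d`.
    refine ⟨Sum.elim (fun _ => 0) ![x, (nonsquare p / r) • y], ?_⟩
    have hval : nonsquare p / r * (nonsquare p / r * b y y) = -nonsquare p := by
      field_simp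
      linear_combination -nonsquare p * hr
    rintro ((i | i) | i)
    · exact i.elim0
    · exact i.elim0
    rintro ((j | j) | j)
    · exact j.elim0
    · exact j.elim0
    fin_cases i <;> fin_cases j <;> simp [gramMinus, hx, hxy, hyx, hval]
  | succ m ih =>
    intro V _ _ _ b hs hb hn hiso
    obtain ⟨e, he, hee⟩ := exists_isotropic hp hs hb (by omega)
    obtain ⟨f, hf, hef⟩ := exists_hyperbolic_pair (ZMod.two_ne_zero_of_ne_two hp) hs hb he hee
    have h1 := finrank_pairOrthogonal hs.isRefl hb hee hf hef
    obtain ⟨v, hv⟩ := ih (hs.restrict (pairOrthogonal b e f))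
      (nondegenerate_restrict_pairOrthogonal hs.isRefl hb hee hf hef) (by omega)
      (fun h => hiso (h.succ hs.isRefl hee hef))
    obtain ⟨w, hw, hw0⟩ := exists_gramPlus_succ hs hee hf hef (v := fun i => v (Sum.inl i))
      (fun i j => hv _ _)
    have h2 : ∀ i j, b (w i) (v (Sum.inr j)) = 0 := fun i j =>
      hw0 i _ (mem_pairOrthogonal.1 (v _).2).1 (mem_pairOrthogonal.1 (v _).2).2
        fun k => hv (Sum.inl k) (Sum.inr j)
    refine ⟨Sum.elim w fun j => v (Sum.inr j), ?_⟩
    rintro (i | i) (j | j)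
    · exact hw i j
    · exact h2 i j
    · exact (hs.eq _ _).trans (h2 j i)
    · exact hv (Sum.inr i) (Sum.inr j)

end minus

/-! ### From Gram matrices to isomorphisms of isometry groups. -/

section groups

open Module

/-- Conjugation by a linear equivalence, as an isomorphism of automorphism groups. -/
def LinearEquiv.conjAut {K V W : Type*} [CommRing K] [AddCommGroup V] [Module K V] [AddCommGroup W]
    [Module K W] (e : V ≃ₗ[K] W) : (V ≃ₗ[K] V) ≃* (W ≃ₗ[K] W) where
  toFun g := e.symm.trans (g.trans e)
  invFun g := e.trans (g.trans e.symm)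
  left_inv g := by ext x; simp
  right_inv g := by ext x; simp
  map_mul' g h := by ext x; simp

theorem LinearEquiv.conjAut_apply {K V W : Type*} [CommRing K] [AddCommGroup V] [Module K V]
    [AddCommGroup W] [Module K W] (e : V ≃ₗ[K] W) (g : V ≃ₗ[K] V) (x : W) :
    e.conjAut g x = e (g (e.symm x)) := rfl

theorem nonempty_orthogonalGroup_mulEquiv {K V W : Type*} [CommRing K] [AddCommGroup V]
    [Module K V] [AddCommGroup W] [Module K W] {b : LinearMap.BilinForm K V}
    {c : LinearMap.BilinForm K W} (e : V ≃ₗ[K] W) (h : ∀ x y, c (e x) (e y) = b x y) :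
    Nonempty (orthogonalGroup b ≃* orthogonalGroup c) := by
  have hmap : orthogonalGroup c = (orthogonalGroup b).map e.conjAut.toMonoidHom := by
    ext g
    rw [Subgroup.mem_map_equiv]
    have hg : ∀ x, e (e.conjAut.symm g x) = g (e x) := fun x => e.apply_symm_apply _
    constructor
    · intro hgc x y
      rw [← h, hg, hg, hgc, h]
    · intro hgb x y
      have := hgb (e.symm x) (e.symm y)
      rw [← h, ← h, hg, hg] at this
      simpa using this
  rw [hmap]
  exact ⟨(orthogonalGroup b).equivMapOfInjective _ e.conjAut.injective⟩

theorem exists_linearEquiv_of_gram {K V ι : Type*} [Field K] [AddCommGroup V] [Module K V]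
    [FiniteDimensional K V] [Fintype ι] [DecidableEq ι] {b : LinearMap.BilinForm K V}
    {M : Matrix ι ι K} (hM : M.det ≠ 0) (hι : Fintype.card ι = finrank K V) {v : ι → V}
    (hv : ∀ i j, b (v i) (v j) = M i j) :
    ∃ e : V ≃ₗ[K] (ι → K), ∀ x y, Matrix.toBilin' M (e x) (e y) = b x y := by
  have hli : LinearIndependent K v := by
    rw [Fintype.linearIndependent_iff]
    intro g hg
    -- Pairing a linear relation with each `v i` puts its coefficients in the kernel of the
    -- invertible Gram matrix.
    refine congrFun (Matrix.eq_zero_of_mulVec_eq_zero hM ?_)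
    ext i
    have := congrArg (b (v i)) hg
    simpa [hv, Matrix.mulVec, dotProduct, mul_comm] using this
  let B : Basis ι K V := Basis.mk hli
    (hli.span_eq_top_of_card_eq_finrank' hι).ge
  refine ⟨B.equivFun, fun x y => ?_⟩
  have : (Matrix.toBilin' M).comp (B.equivFun : V →ₗ[K] ι → K) (B.equivFun : V →ₗ[K] ι → K) = b := by
    refine LinearMap.BilinForm.ext_basis B fun i j => ?_
    have hB : ∀ i, B.equivFun (B i) = Pi.single i 1 := fun i => by
      ext j
      rw [Basis.equivFun_self, Pi.single_apply]
      simp only [eq_comm]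
    rw [LinearMap.BilinForm.comp_apply, LinearEquiv.coe_coe, hB, hB, Matrix.toBilin'_single]
    simp [B, hv]
  exact LinearMap.congr_fun₂ this x y

variable {p : ℕ} [Fact p.Prime]

theorem det_gramPlus_ne_zero (m : ℕ) : (gramPlus m p).det ≠ 0 := by
  have h : gramPlus m p * gramPlus m p = 1 := by simp [gramPlus, Matrix.fromBlocks_multiply]
  exact (Matrix.isUnit_det_of_left_inverse h).ne_zero

theorem det_gramMinus_ne_zero (hp : p ≠ 2) (m : ℕ) : (gramMinus m p).det ≠ 0 := by
  have hd : nonsquare p ≠ 0 := fun h => nonsquare_spec hp (h ▸ IsSquare.zero)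
  rw [gramMinus, Matrix.det_fromBlocks_zero₂₁, Matrix.det_diagonal]
  simp [det_gramPlus_ne_zero, hd]

/-- In characteristic two `-1 = 1`, so the hyperbolic Gram matrix is the symplectic matrix `J`. -/
theorem nonempty_orthogonalGroup_mulEquiv_symplecticGroup (m : ℕ) :
    Nonempty (orthogonalGroup (Matrix.toBilin' (gramPlus m 2)) ≃*
      Matrix.symplecticGroup (Fin m) (ZMod 2)) := by
  have hJ : gramPlus m 2 = Matrix.J (Fin m) (ZMod 2) := by
    have : (-1 : Matrix (Fin m) (Fin m) (ZMod 2)) = 1 := by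
      ext i j
      rw [Matrix.neg_apply, ZMod.neg_eq_self_mod_two]
    rw [gramPlus, Matrix.J, this]
  rw [hJ]
  have key : ∀ A : Matrix (Fin m ⊕ Fin m) (Fin m ⊕ Fin m) (ZMod 2),
      A ∈ Matrix.symplecticGroup (Fin m) (ZMod 2) ↔ ∀ x y,
        Matrix.toBilin' (Matrix.J (Fin m) (ZMod 2)) (Matrix.toLin' A x) (Matrix.toLin' A y) =
          Matrix.toBilin' (Matrix.J (Fin m) (ZMod 2)) x y := by
    intro A
    rw [SymplecticGroup.mem_iff', ← (Matrix.toBilin').injective.eq_iff, ← Matrix.toBilin'_comp]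
    exact LinearMap.ext_iff₂
  let φ : orthogonalGroup (Matrix.toBilin' (Matrix.J (Fin m) (ZMod 2))) →*
      Matrix.symplecticGroup (Fin m) (ZMod 2) :=
    { toFun := fun g => ⟨LinearMap.toMatrix' (g.1 : (Fin m ⊕ Fin m → ZMod 2) →ₗ[ZMod 2] _),
        (key _).2 fun x y => by rw [Matrix.toLin'_toMatrix']; exact g.2 x y⟩
      map_one' := Subtype.ext LinearMap.toMatrix'_one
      map_mul' := fun g h => Subtype.ext (LinearMap.toMatrix'_mul _ _) }
  refine ⟨MulEquiv.ofBijective φ ⟨fun g h hgh => ?_, fun A => ?_⟩⟩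
  · exact Subtype.ext (LinearEquiv.toLinearMap_injective
      (LinearMap.toMatrix'.injective (congrArg Subtype.val hgh)))
  · refine ⟨⟨Matrix.toLin'OfInv (M := (A⁻¹).1) (M' := A.1) (congrArg Subtype.val (inv_mul_cancel A))
      (congrArg Subtype.val (mul_inv_cancel A)), (key A.1).1 A.2⟩, Subtype.ext ?_⟩
    exact LinearMap.toMatrix'_toLin' A.1

end groups

/-! ### Consequences of a fixed-point-free automorphism of prime or odd order. -/

section fixedPointFree

open Module

/-- An automorphism of prime order `q` without non-zero fixed vectors acts freely on the non-zero
vectors, so the size of an invariant finite set containing `0` is `1` modulo `q`. -/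
theorem card_modEq_one_of_invariant {q : ℕ} [Fact q.Prime] {K V : Type*} [CommRing K]
    [AddCommGroup V] [Module K V] [Finite V] {f : V ≃ₗ[K] V} (hf : f ^ q = 1)
    (hfix : ∀ x, f x = x → x = 0) (S : Set V) (h0 : (0 : V) ∈ S) (hS : ∀ x ∈ S, f x ∈ S) :
    Nat.card S ≡ 1 [MOD q] := by
  classical
  have := Fintype.ofFinite S
  let g : Function.End S := fun x => ⟨f x, hS x x.2⟩
  have hg : ∀ (n : ℕ) (x : S), (((g ^ n) x : S) : V) = (f ^ n) x := by
    intro n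
    induction n with
    | zero => intro x; rfl
    | succ n ih =>
      intro x
      rw [pow_succ, pow_succ, LinearEquiv.mul_apply]
      exact ih (g x)
  have hg1 : g ^ q ^ 1 = 1 := by
    funext x
    apply Subtype.ext
    rw [hg, pow_one, hf]
    rfl
  have h1 := Equiv.Perm.card_fixedPoints_modEq hg1
  have h2 : Fintype.card (Function.fixedPoints g) = 1 := by
    rw [Fintype.card_eq_one_iff]
    refine ⟨⟨⟨0, h0⟩, Subtype.ext (map_zero f)⟩, fun y => ?_⟩
    apply Subtype.ext
    apply Subtype.ext
    exact hfix _ (congrArg Subtype.val y.2)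
  rw [Nat.card_eq_fintype_card]
  simpa only [h2] using h1

theorem cast_pow_finrank_eq_one {q p : ℕ} [Fact q.Prime] [Fact p.Prime] {V : Type*}
    [AddCommGroup V] [Module (ZMod p) V] [Module.Finite (ZMod p) V] {f : V ≃ₗ[ZMod p] V}
    (hf : f ^ q = 1) (hfix : ∀ x, f x = x → x = 0) (W : Submodule (ZMod p) V)
    (hW : ∀ x ∈ W, f x ∈ W) : (p : ZMod q) ^ finrank (ZMod p) W = 1 := by
  have : Finite V := Module.finite_of_finite (ZMod p)
  have h := card_modEq_one_of_invariant hf hfix W W.zero_mem hW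
  have h2 : Nat.card (W : Set V) = p ^ finrank (ZMod p) W := by
    have := Module.natCard_eq_pow_finrank (K := ZMod p) (V := W)
    rwa [Nat.card_zmod] at this
  rw [h2, ← ZMod.natCast_eq_natCast_iff] at h
  simpa using h

theorem pow_two_mul_add_one_apply {K V : Type*} [CommRing K] [AddCommGroup V] [Module K V]
    {f : V ≃ₗ[K] V} {x : V} (h : f (f x) = x) (t : ℕ) : (f ^ (2 * t + 1)) x = f x := by
  induction t with
  | zero => simp
  | succ t ih =>
    rw [show 2 * (t + 1) + 1 = (2 * t + 1) + 1 + 1 by ring, pow_succ, pow_succ,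
      LinearEquiv.mul_apply, LinearEquiv.mul_apply, h, ih]

/-- A non-singular symmetric form that admits an isometry of odd order without non-zero fixed
vectors lives in even dimension. -/
theorem even_finrank_of_isometry {q : ℕ} (hq : Odd q) {K V : Type*} [Field K] [AddCommGroup V]
    [Module K V] [FiniteDimensional K V] {b : LinearMap.BilinForm K V} (hs : b.IsSymm)
    (hb : b.Nondegenerate) {f : V ≃ₗ[K] V} (hf : f ^ q = 1) (hfb : f ∈ orthogonalGroup b)
    (hfix : ∀ x, f x = x → x = 0) : Even (finrank K V) := by
  let c : LinearMap.BilinForm K V :=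
    LinearMap.BilinForm.compRight b (f : V →ₗ[K] V) - LinearMap.BilinForm.compLeft b (f : V →ₗ[K] V)
  have hc : ∀ x y, c x y = b x (f y) - b (f x) y := fun x y => rfl
  have ha : c.IsAlt := fun x => by rw [hc, hs.eq, sub_self]
  refine even_finrank_of_isAlt _ ha ?_ rfl
  refine (LinearMap.IsRefl.nondegenerate_iff_separatingLeft (B := c) ha.isRefl).2 ?_
  intro x hx
  -- Testing a radical vector of `c` against `f⁻¹ y` gives `b x y = b (f (f x)) y`. As the order is
  -- odd, `f (f x) = x` then forces `f x = x`.
  have h1 : x - f (f x) = 0 := hb.1 _ fun y => by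
    have h2 := hx (f⁻¹ y)
    have h3 : f (f⁻¹ y) = y := f.apply_symm_apply y
    rw [hc, ← hfb (f x), h3] at h2
    simpa using h2
  obtain ⟨t, rfl⟩ := hq
  refine hfix x ?_
  rw [← pow_two_mul_add_one_apply (sub_eq_zero.1 h1).symm t, hf]
  rfl

/-- Over `ZMod 2`, a symmetric form with an isometry `f` such that `f - 1` is onto is alternating. -/
theorem isAlt_of_isometry {V : Type*} [AddCommGroup V] [Module (ZMod 2) V]
    {b : LinearMap.BilinForm (ZMod 2) V} (hs : b.IsSymm) {f : V ≃ₗ[ZMod 2] V}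
    (hfb : f ∈ orthogonalGroup b) (hsurj : Function.Surjective fun v => f v - v) : b.IsAlt := by
  intro x
  obtain ⟨y, rfl⟩ := hsurj x
  have h1 := hfb y y
  have h2 := hs.eq (f y) y
  simp only [map_sub, LinearMap.sub_apply]
  rw [h1, h2, show b y y - b y (f y) - (b y (f y) - b y y) = 2 * (b y y - b y (f y)) by ring]
  have : (2 : ZMod 2) = 0 := rfl
  rw [this, zero_mul]

/-- There is a non-zero invariant subspace of dimension at most the order of `p` modulo `q`. -/
theorem exists_invariant_finrank_le {q p : ℕ} [Fact q.Prime] [Fact p.Prime] (hne : p ≠ q)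
    {V : Type*} [AddCommGroup V] [Module (ZMod p) V] [Module.Finite (ZMod p) V] [Nontrivial V]
    {f : V ≃ₗ[ZMod p] V} (hf : f ^ q = 1) (hfix : ∀ x, f x = x → x = 0) :
    ∃ W : Submodule (ZMod p) V, W ≠ ⊥ ∧ (∀ x ∈ W, f x ∈ W) ∧
      finrank (ZMod p) W ≤ orderOf (p : ZMod q) := by
  open Polynomial UniqueFactorizationMonoid in
  classical
  let F : End (ZMod p) V := f
  have hF : F ^ q = 1 := by
    ext x
    have : (F ^ q) x = (f ^ q) x := by
      rw [Module.End.pow_apply, LinearEquiv.pow_apply]; rfl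
    rw [this, hf]
    rfl
  -- `F - 1` is injective, so it cancels from `X ^ q - 1 = (X - 1) * cyclotomic q`.
  have hcyc : aeval F (cyclotomic q (ZMod p)) = 0 := by
    have h1 : aeval F (cyclotomic q (ZMod p) * (X - 1)) = 0 := by
      rw [cyclotomic_prime_mul_X_sub_one]; simp [hF]
    ext x
    have h2 := LinearMap.congr_fun h1 x
    rw [mul_comm, map_mul, Module.End.mul_apply] at h2
    refine hfix _ (sub_eq_zero.1 ?_)
    simp only [map_sub, aeval_X, map_one, LinearMap.sub_apply, Module.End.one_apply] at h2
    exact h2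
  have hne' : cyclotomic q (ZMod p) ≠ 0 := cyclotomic_ne_zero _ _
  -- Were every irreducible factor injective on `V`, their product would be too, yet it acts as
  -- zero.
  have hex : ∃ g ∈ normalizedFactors (cyclotomic q (ZMod p)), ∃ v ≠ 0, aeval F g v = 0 := by
    by_contra! hcon
    obtain ⟨v, hv⟩ := exists_ne (0 : V)
    have hprod : ∀ s : Multiset (ZMod p)[X], (∀ g ∈ s, ∀ v ≠ 0, aeval F g v ≠ 0) →
        aeval F s.prod v ≠ 0 := by
      intro s
      induction s using Multiset.induction_on with
      | empty => intro _; simpa using hv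
      | cons g s ih =>
        intro h
        rw [Multiset.prod_cons, map_mul, Module.End.mul_apply]
        exact h g (Multiset.mem_cons_self g s) _
          (ih fun g' hg' => h g' (Multiset.mem_cons_of_mem hg'))
    refine hprod _ hcon ?_
    obtain ⟨u, hu⟩ := (prod_normalizedFactors hne').symm
    rw [← hu, map_mul, hcyc, zero_mul]
    rfl
  obtain ⟨g, hg, v, hv, hgv⟩ := hex
  have hdeg : g.natDegree = orderOf (p : ZMod q) := by
    have hcop : p.Coprime q := (Nat.coprime_primes Fact.out Fact.out).2 hne
    rw [Polynomial.natDegree_of_mem_normalizedFactors_cyclotomic (K := ZMod p) (p := p) (f := 1)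
      (by simp) hcop hg, ← orderOf_units]
    simp
  have hg0 : g ≠ 0 := (irreducible_of_normalized_factor g hg).ne_zero
  -- The subspace sought is the cyclic one generated by `v`. Since `g` kills `v`, remainders modulo
  -- `g` already fill it, which bounds its dimension by `deg g`.
  let φ : (ZMod p)[X] →ₗ[ZMod p] V := (LinearMap.applyₗ v).comp (aeval F).toLinearMap
  have hφ : ∀ r, φ r = aeval F r v := fun r => rfl
  have hmod : ∀ r, φ r = φ (r % g) := by
    intro r
    conv_lhs => rw [← EuclideanDomain.mod_add_div r g]
    rw [map_add, hφ (g * _), mul_comm, map_mul, Module.End.mul_apply, hgv, map_zero, add_zero]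
  have hlt : ∀ r, r % g ∈ degreeLT (ZMod p) (orderOf (p : ZMod q)) := by
    intro r
    rw [mem_degreeLT, ← hdeg, ← degree_eq_natDegree hg0]
    exact EuclideanDomain.mod_lt r hg0
  refine ⟨(degreeLT (ZMod p) (orderOf (p : ZMod q))).map φ, ?_, ?_, ?_⟩
  · rw [Submodule.ne_bot_iff]
    exact ⟨v, ⟨1 % g, hlt 1, by rw [← hmod, hφ]; simp⟩, hv⟩
  · rintro x ⟨r, -, rfl⟩
    refine ⟨(X * r) % g, hlt _, ?_⟩
    rw [← hmod, hφ, hφ, map_mul, aeval_X]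
    rfl
  · have : Module.Finite (ZMod p) (degreeLT (ZMod p) (orderOf (p : ZMod q))) :=
      Module.Finite.equiv (degreeLTEquiv (ZMod p) _).symm
    refine (Submodule.finrank_map_le _ _).trans ?_
    rw [(degreeLTEquiv (ZMod p) (orderOf (p : ZMod q))).finrank_eq]
    simp

end fixedPointFree

/-! ### Counting isotropic vectors modulo `q`. -/

section isotropicCount

open Module

variable {p : ℕ} [Fact p.Prime]

/-- For `y ≠ 0` the solutions form a hyperplane; `y = 0` is exceptional. The correction is added on
both sides to avoid truncated subtraction when summing over `y`. -/
theorem card_dotProduct_eq_zero {m : ℕ} (hm : 0 < m) (y : Fin m → ZMod p) :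
    Fintype.card {z : Fin m → ZMod p // y ⬝ᵥ z = 0} + (if y = 0 then p ^ (m - 1) else 0) =
      p ^ (m - 1) + if y = 0 then p ^ m else 0 := by
  split_ifs with hy
  · subst hy
    simp [Fintype.card_subtype, ZMod.card, add_comm]
  · let φ : (Fin m → ZMod p) →ₗ[ZMod p] ZMod p := dotProductBilin (ZMod p) (ZMod p) y
    have hφ : ∀ z, φ z = y ⬝ᵥ z := fun z => rfl
    have hne : φ ≠ 0 := fun h => hy (by
      ext i
      have := LinearMap.congr_fun h (Pi.single i 1)
      rw [hφ] at this
      simpa using this)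
    have h1 := LinearMap.finrank_range_add_finrank_ker φ
    rw [LinearMap.range_eq_top.2 (LinearMap.surjective hne), finrank_top, finrank_self,
      finrank_fin_fun] at h1
    have h2 : Nat.card (LinearMap.ker φ) = p ^ finrank (ZMod p) (LinearMap.ker φ) := by
      have := Module.natCard_eq_pow_finrank (K := ZMod p) (V := LinearMap.ker φ)
      rwa [Nat.card_zmod] at this
    rw [← Nat.card_eq_fintype_card, add_zero, add_zero, show m - 1 = finrank (ZMod p)
      (LinearMap.ker φ) by omega, ← h2]
    rfl

/-- The number of isotropic vectors of an orthogonal sum of `m` hyperbolic planes. -/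
theorem card_isotropic_hyperbolic {m : ℕ} (hm : 0 < m) :
    Nat.card {w : (Fin m → ZMod p) × (Fin m → ZMod p) // w.1 ⬝ᵥ w.2 = 0} + p ^ (m - 1) =
      p ^ m * p ^ (m - 1) + p ^ m := by
  rw [Nat.card_congr (Equiv.subtypeProdEquivSigmaSubtype fun y z : Fin m → ZMod p => y ⬝ᵥ z = 0),
    Nat.card_eq_fintype_card, Fintype.card_sigma]
  have := Finset.sum_congr rfl fun y (_ : y ∈ Finset.univ) => card_dotProduct_eq_zero (p := p) hm y
  simpa [Finset.sum_add_distrib, ZMod.card] using this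

theorem toBilin'_gramPlus_self (m : ℕ) (w : Fin m ⊕ Fin m → ZMod p) :
    Matrix.toBilin' (gramPlus m p) w w = 2 * ((fun i => w (Sum.inl i)) ⬝ᵥ fun i => w (Sum.inr i)) := by
  rw [Matrix.toBilin'_apply', gramPlus, Matrix.fromBlocks_mulVec]
  simp [dotProduct, two_mul, mul_comm, Function.comp_def]

theorem card_isotropic_of_hasTotallyIsotropic (hp : p ≠ 2) {m : ℕ} {V : Type*}
    [AddCommGroup V] [Module (ZMod p) V] [Module.Finite (ZMod p) V]
    {b : LinearMap.BilinForm (ZMod p) V} (hs : b.IsSymm) (hb : b.Nondegenerate)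
    (hn : finrank (ZMod p) V = 2 * m) (h : HasTotallyIsotropic b m) :
    Nat.card {x : V | b x x = 0} =
      Nat.card {w : (Fin m → ZMod p) × (Fin m → ZMod p) // w.1 ⬝ᵥ w.2 = 0} := by
  obtain ⟨v, hv⟩ := exists_gramPlus_of_hasTotallyIsotropic hp m hs hb hn h
  have hcard : Fintype.card (Fin m ⊕ Fin m) = finrank (ZMod p) V := by
    rw [hn, Fintype.card_sum, Fintype.card_fin, two_mul]
  obtain ⟨e, he⟩ := exists_linearEquiv_of_gram (K := ZMod p) (det_gramPlus_ne_zero (p := p) m) hcard hv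
  let E : V ≃ (Fin m → ZMod p) × (Fin m → ZMod p) :=
    e.toEquiv.trans (Equiv.sumArrowEquivProdArrow _ _ _)
  have hE : ∀ x, b x x = 2 * ((E x).1 ⬝ᵥ (E x).2) := fun x => by
    rw [← he, toBilin'_gramPlus_self]
    rfl
  refine Nat.card_congr (E.subtypeEquiv fun x => ?_)
  rw [Set.mem_ofPred_eq, hE, mul_eq_zero, or_iff_right (ZMod.two_ne_zero_of_ne_two hp)]

/-- With `r = p ^ (m - 1)` and `p ^ m = -1`, a count of `1` modulo `q` reads `1 + r = -r - 1`. Hence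
`r = -1 = p * r`, and `p = 1` modulo `q`. -/
theorem card_isotropic_hyperbolic_not_modEq_one {q m : ℕ} [Fact q.Prime] (hq : q ≠ 2)
    (hm : 0 < m) (hpm : (p : ZMod q) ^ m = -1) (hp1 : (p : ZMod q) ≠ 1) :
    ¬ Nat.card {w : (Fin m → ZMod p) × (Fin m → ZMod p) // w.1 ⬝ᵥ w.2 = 0} ≡ 1 [MOD q] := by
  intro h1
  have h3 := card_isotropic_hyperbolic (p := p) hm
  generalize Nat.card {w : (Fin m → ZMod p) × (Fin m → ZMod p) // w.1 ⬝ᵥ w.2 = 0} = N at h1 h3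
  rw [← ZMod.natCast_eq_natCast_iff] at h1
  have h4 := congrArg (Nat.cast (R := ZMod q)) h3
  push_cast at h4 h1
  have h7 : (p : ZMod q) ^ m = p * (p : ZMod q) ^ (m - 1) := by
    rw [← pow_succ', Nat.sub_add_cancel hm]
  rw [h1, hpm] at h4
  rw [hpm] at h7
  generalize (p : ZMod q) ^ (m - 1) = r at h4 h7
  have h5 : (2 : ZMod q) * (1 + r) = 0 := by linear_combination h4
  have h6 := (mul_eq_zero.1 h5).resolve_left (ZMod.two_ne_zero_of_ne_two hq)
  apply hp1
  linear_combination (p : ZMod q) * h6 + h7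

theorem not_hasTotallyIsotropic_of_isometry {q m : ℕ} [Fact q.Prime] (hq : q ≠ 2) (hp : p ≠ 2)
    (hm : 0 < m) (hpm : (p : ZMod q) ^ m = -1) (hp1 : (p : ZMod q) ≠ 1) {V : Type*}
    [AddCommGroup V] [Module (ZMod p) V] [Module.Finite (ZMod p) V]
    {b : LinearMap.BilinForm (ZMod p) V} (hs : b.IsSymm) (hb : b.Nondegenerate)
    {f : V ≃ₗ[ZMod p] V} (hf : f ^ q = 1) (hfb : f ∈ orthogonalGroup b)
    (hfix : ∀ x, f x = x → x = 0) (hn : finrank (ZMod p) V = 2 * m) :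
    ¬ HasTotallyIsotropic b m := by
  intro h
  have : Finite V := Module.finite_of_finite (ZMod p)
  have h1 := card_modEq_one_of_invariant hf hfix {x | b x x = 0} (by simp)
    (fun x hx => (hfb x x).trans hx)
  rw [card_isotropic_of_hasTotallyIsotropic hp hs hb hn h] at h1
  exact card_isotropic_hyperbolic_not_modEq_one hq hm hpm hp1 h1

end isotropicCount

/-! ### Construction of isometries of order `q` from finite fields. -/

section existence

open Module

theorem IsOrthogonalPair.transport {q : ℕ} {K V W : Type*} [CommRing K] [AddCommGroup V] [Module K V]
    [AddCommGroup W] [Module K W] {b : LinearMap.BilinForm K V} {f : V ≃ₗ[K] V}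
    (h : IsOrthogonalPair q b f) (e : V ≃ₗ[K] W) :
    IsOrthogonalPair q (LinearMap.BilinForm.congr e b) (e.conjAut f) where
  symm := ⟨fun x y => h.symm.eq _ _⟩
  nondegenerate := h.nondegenerate.congr e
  mem := fun x y => by
    simpa [LinearEquiv.conjAut_apply] using h.mem (e.symm x) (e.symm y)
  order := by rw [MulEquiv.orderOf_eq, h.order]
  bijective := by
    have : (fun x : W => e.conjAut f x - x) = e ∘ (fun x => f x - x) ∘ e.symm := by
      ext x
      simp [LinearEquiv.conjAut_apply]
    rw [this]
    exact e.bijective.comp (h.bijective.comp e.symm.bijective)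

variable {q p : ℕ} [Fact q.Prime] [Fact p.Prime]

/-- The form is `Tr(x * σ y)` with `σ` the `m`-th power of Frobenius. It is symmetric because `σ` is
an involution, and multiplication by `ζ` preserves it because `ζ * σ ζ = 1`. -/
theorem exists_orthogonalPair_even {k : ℕ} (hk : k ≠ 0) {ζ : (GaloisField p k)ˣ}
    (hζ : orderOf ζ = q) {m : ℕ} (hm : k = 2 * m) (hζm : ζ ^ p ^ m * ζ = 1) :
    ∃ (b : LinearMap.BilinForm (ZMod p) (GaloisField p k))
      (f : GaloisField p k ≃ₗ[ZMod p] GaloisField p k), IsOrthogonalPair q b f := by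
  let F := GaloisField p k
  let σ : F ≃ₐ[ZMod p] F := FiniteField.frobeniusAlgEquivOfAlgebraic (ZMod p) F ^ m
  have hσ : ∀ x, σ x = x ^ p ^ m := fun x => by
    rw [AlgEquiv.coe_pow, FiniteField.coe_frobeniusAlgEquivOfAlgebraic_iterate, ZMod.card]
  have hσσ : ∀ x, σ (σ x) = x := fun x => by
    have := Fintype.ofFinite F
    rw [hσ, hσ, ← pow_mul, ← pow_add, ← two_mul, ← hm, ← GaloisField.card p k hk,
      Nat.card_eq_fintype_card, FiniteField.pow_card]
  have hζ1 : ζ ≠ 1 := by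
    rintro rfl
    rw [orderOf_one] at hζ
    exact (Fact.out : q.Prime).one_lt.ne hζ
  let f : F ≃ₗ[ZMod p] F := DistribMulAction.toModuleAut (ZMod p) F ζ
  have hf : ∀ x, f x = ζ * x := fun x => rfl
  let b : LinearMap.BilinForm (ZMod p) F :=
    LinearMap.BilinForm.compRight (Algebra.traceForm (ZMod p) F) σ.toLinearMap
  have hb : ∀ x y, b x y = Algebra.trace (ZMod p) F (x * σ y) := fun x y => rfl
  have hsymm : b.IsSymm := ⟨fun x y => by
    rw [hb, hb, ← Algebra.trace_eq_of_algEquiv σ (x * σ y), map_mul, hσσ, mul_comm]⟩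
  have hbij : ∀ x, f x - x = (ζ - 1) * x := fun x => by rw [hf]; ring
  have hζ0 : (ζ - 1 : F) ≠ 0 := fun h => hζ1 (Units.ext (sub_eq_zero.1 h))
  refine ⟨b, f, hsymm, ?_, ?_, ?_, ?_⟩
  · refine (LinearMap.IsRefl.nondegenerate_iff_separatingLeft (B := b) hsymm.isRefl).2 fun x hx => ?_
    refine (traceForm_nondegenerate (ZMod p) F).1 x fun y => ?_
    have := hx (σ y)
    rwa [hb, hσσ] at this
  · intro x y
    have h1 : (ζ : F) * (ζ : F) ^ p ^ m = 1 := by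
      have := congrArg Units.val hζm
      rwa [Units.val_mul, Units.val_pow_eq_pow_val, Units.val_one, mul_comm] at this
    rw [hb, hb, hf, hf, map_mul σ, hσ ζ]
    congr 1
    linear_combination x * σ y * h1
  · refine orderOf_eq_prime ?_ fun h => hζ1 ?_
    · rw [← map_pow, ← hζ, pow_orderOf_eq_one, map_one]
    · have h1 := LinearEquiv.congr_fun h 1
      rw [hf, mul_one] at h1
      exact Units.ext h1
  · rw [funext hbij]
    exact mulLeft_bijective₀ _ hζ0

/-- The trace pairs the two factors with each other, so acting by `ζ` on one and `ζ⁻¹` on the other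
cancels. -/
theorem exists_orthogonalPair_hyperbolic {k : ℕ} {ζ : (GaloisField p k)ˣ} (hζ : orderOf ζ = q) :
    ∃ (b : LinearMap.BilinForm (ZMod p) (GaloisField p k × GaloisField p k))
      (f : (GaloisField p k × GaloisField p k) ≃ₗ[ZMod p] (GaloisField p k × GaloisField p k)),
      IsOrthogonalPair q b f := by
  let F := GaloisField p k
  have hζ1 : ζ ≠ 1 := by
    rintro rfl
    rw [orderOf_one] at hζ
    exact (Fact.out : q.Prime).one_lt.ne hζ
  let μ : Fˣ →* (F ≃ₗ[ZMod p] F) := DistribMulAction.toModuleAut (ZMod p) F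
  have hμ : ∀ u x, μ u x = u * x := fun u x => rfl
  let f : (F × F) ≃ₗ[ZMod p] (F × F) := (μ ζ).prodCongr (μ ζ⁻¹)
  have hf : ∀ x, f x = (ζ * x.1, (ζ⁻¹ : Fˣ) * x.2) := fun x => rfl
  let T := Algebra.traceForm (ZMod p) F
  let b : LinearMap.BilinForm (ZMod p) (F × F) :=
    LinearMap.BilinForm.comp T (LinearMap.fst _ F F) (LinearMap.snd _ F F) +
      LinearMap.BilinForm.comp T (LinearMap.snd _ F F) (LinearMap.fst _ F F)
  have hb : ∀ x y, b x y = Algebra.trace (ZMod p) F (x.1 * y.2) +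
    Algebra.trace (ZMod p) F (x.2 * y.1) := fun x y => rfl
  have hsymm : b.IsSymm := ⟨fun x y => by
    rw [hb, hb, add_comm, mul_comm x.1, mul_comm x.2]⟩
  have hz : (ζ : F) * ((ζ⁻¹ : Fˣ) : F) = 1 := ζ.mul_inv
  have hζ0 : (ζ - 1 : F) ≠ 0 := fun h => hζ1 (Units.ext (sub_eq_zero.1 h))
  have hζ0' : (((ζ⁻¹ : Fˣ) : F) - 1) ≠ 0 := fun h =>
    hζ1 (inv_eq_one.1 (Units.ext (sub_eq_zero.1 h)))
  refine ⟨b, f, hsymm, ?_, ?_, ?_, ?_⟩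
  · refine (LinearMap.IsRefl.nondegenerate_iff_separatingLeft (B := b) hsymm.isRefl).2 fun x hx => ?_
    refine Prod.ext ((traceForm_nondegenerate (ZMod p) F).1 x.1 fun y => ?_)
      ((traceForm_nondegenerate (ZMod p) F).1 x.2 fun y => ?_)
    · have := hx (0, y)
      rw [hb] at this
      simpa using this
    · have := hx (y, 0)
      rw [hb] at this
      simpa using this
  · intro x y
    rw [hb, hb, hf, hf]
    congr 2
    · linear_combination x.1 * y.2 * hz
    · linear_combination x.2 * y.1 * hz
  · refine orderOf_eq_prime ?_ fun h => hζ1 ?_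
    · have hpow : ∀ n x, (f ^ n) x = (μ (ζ ^ n) x.1, μ (ζ⁻¹ ^ n) x.2) := by
        intro n
        induction n with
        | zero => intro x; simp
        | succ n ih =>
          intro x
          rw [pow_succ, LinearEquiv.mul_apply, ih, pow_succ, pow_succ, map_mul, map_mul]
          rfl
      ext x : 1
      rw [hpow, ← hζ, inv_pow, pow_orderOf_eq_one, inv_one, map_one]
      rfl
    · have h1 := congrArg Prod.fst (LinearEquiv.congr_fun h (1, 1))
      rw [hf, mul_one] at h1
      exact Units.ext h1
  · have : (fun x : F × F => f x - x) =
        Prod.map (fun x : F => (ζ - 1 : F) * x) (fun x => (((ζ⁻¹ : Fˣ) : F) - 1) * x) := by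
      funext x
      rw [hf]
      ext
      · simp [sub_mul]
      · simp [sub_mul]
    rw [this]
    exact (mulLeft_bijective₀ _ hζ0).prodMap
      (mulLeft_bijective₀ (((ζ⁻¹ : Fˣ) : F) - 1) hζ0')

end existence

/-! ### The isotropic subspace for odd `k`, the lower bound and its attainment. -/

section lagrangian

open Module

namespace IsOrthogonalPair

variable {q : ℕ} {K V : Type*} [CommRing K] [AddCommGroup V] [Module K V]
  {b : LinearMap.BilinForm K V} {f : V ≃ₗ[K] V}

theorem pow_eq_one (h : IsOrthogonalPair q b f) : f ^ q = 1 := by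
  rw [← h.order, pow_orderOf_eq_one]

theorem eq_zero_of_apply_eq (h : IsOrthogonalPair q b f) (x : V) (hx : f x = x) : x = 0 :=
  h.bijective.1 (by simp [hx])

theorem nontrivial [Fact q.Prime] (h : IsOrthogonalPair q b f) : Nontrivial V := by
  by_contra hV
  rw [not_nontrivial_iff_subsingleton] at hV
  have h1 : f = 1 := by
    ext x
    exact Subsingleton.elim _ _
  have h2 := h.order
  rw [h1, orderOf_one] at h2
  exact (Fact.out : q.Prime).one_lt.ne h2

end IsOrthogonalPair

variable {q p : ℕ} [Fact q.Prime] [Fact p.Prime]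

theorem hasTotallyIsotropic_of_odd_orderOf (hq : Odd q) (hne : p ≠ q)
    (hk : Odd (orderOf (p : ZMod q))) {V : Type*} [AddCommGroup V] [Module (ZMod p) V]
    [Module.Finite (ZMod p) V] {b : LinearMap.BilinForm (ZMod p) V} {f : V ≃ₗ[ZMod p] V}
    (h : IsOrthogonalPair q b f) : HasTotallyIsotropic b (orderOf (p : ZMod q)) := by
  have := h.nontrivial
  have hf := h.pow_eq_one
  have hfix := h.eq_zero_of_apply_eq
  obtain ⟨W, hW0, hW, hle⟩ := exists_invariant_finrank_le hne hf hfix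
  have hdim : ∀ U : Submodule (ZMod p) V, U ≠ ⊥ → (∀ x ∈ U, f x ∈ U) →
      orderOf (p : ZMod q) ≤ finrank (ZMod p) U := fun U hU0 hU =>
    Nat.le_of_dvd (Nat.pos_of_ne_zero fun h0 => hU0 (Submodule.finrank_eq_zero.1 h0))
      (orderOf_dvd_of_pow_eq_one (cast_pow_finrank_eq_one hf hfix U hU))
  have hWk := le_antisymm hle (hdim W hW0 hW)
  let g : W ≃ₗ[ZMod p] W := LinearEquiv.ofInjectiveEndo ((f : V →ₗ[ZMod p] V).restrict hW)
    fun x y hxy => Subtype.ext (f.injective (congrArg Subtype.val hxy))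
  have hg : ∀ x : W, (g x : V) = f x := fun x => rfl
  have hgn : ∀ (n : ℕ) (x : W), ((g ^ n) x : V) = (f ^ n) x := by
    intro n
    induction n with
    | zero => intro x; rfl
    | succ n ih =>
      intro x
      rw [pow_succ, pow_succ, LinearEquiv.mul_apply, LinearEquiv.mul_apply, ih, hg]
  -- `f` maps the finite-dimensional `W` onto itself, so each `y ∈ W` is an `f`-image of a vector of
  -- `W`.
  have hperp : ∀ x ∈ W ⊓ b.orthogonal W, f x ∈ W ⊓ b.orthogonal W := by
    rintro x ⟨hx, hx'⟩
    refine ⟨hW x hx, fun y hy => ?_⟩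
    have h1 : f (g.symm ⟨y, hy⟩) = y := by rw [← hg, LinearEquiv.apply_symm_apply]
    have h2 := h.mem (g.symm ⟨y, hy⟩) x
    rw [h1] at h2
    exact h2.trans (hx' _ (g.symm ⟨y, hy⟩).2)
  by_cases hbot : W ⊓ b.orthogonal W = ⊥
  · exfalso
    have hnd : (b.restrict W).Nondegenerate :=
      LinearMap.BilinForm.nondegenerate_restrict_of_disjoint_orthogonal b h.symm.isRefl
        (disjoint_iff.2 hbot)
    have heven := even_finrank_of_isometry hq (h.symm.restrict W) hnd (f := g)
      (by
        ext x
        rw [hgn, hf]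
        rfl)
      (fun x y => h.mem x y)
      (fun x hx => Subtype.ext (hfix x (congrArg Subtype.val hx)))
    rw [hWk] at heven
    exact (Nat.not_even_iff_odd.2 hk) heven
  -- A non-zero invariant subspace has dimension at least `k = dim W`.
  · have heq : W ⊓ b.orthogonal W = W := Submodule.eq_of_le_of_finrank_le inf_le_left
      (hWk ▸ hdim _ hbot hperp)
    exact ⟨W, hWk, fun x hx y hy => (inf_eq_left.1 heq) hy x hx⟩

theorem orderOf_natCast_pos (hne : p ≠ q) : 0 < orderOf (p : ZMod q) := by
  have hp0 : (p : ZMod q) ≠ 0 := by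
    rw [Ne, ZMod.natCast_eq_zero_iff]
    exact fun h => hne ((Nat.prime_dvd_prime_iff_eq Fact.out Fact.out).1 h).symm
  exact Nat.pos_of_dvd_of_pos (orderOf_dvd_of_pow_eq_one (ZMod.pow_card_sub_one_eq_one hp0))
    (Nat.sub_pos_of_lt (Fact.out : q.Prime).one_lt)

theorem pow_eq_neg_one_of_orderOf_eq (hne : p ≠ q) {m : ℕ}
    (hk : orderOf (p : ZMod q) = 2 * m) : (p : ZMod q) ^ m = -1 := by
  have hpos := orderOf_natCast_pos hne
  have h1 : (p : ZMod q) ^ m * (p : ZMod q) ^ m = 1 := by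
    rw [← pow_add, ← two_mul, ← hk, pow_orderOf_eq_one]
  refine (mul_self_eq_one_iff.1 h1).resolve_left fun h2 => ?_
  have := Nat.le_of_dvd (by omega) (orderOf_dvd_of_pow_eq_one h2)
  omega

theorem exists_unit_orderOf_eq (hne : p ≠ q) :
    ∃ ζ : (GaloisField p (orderOf (p : ZMod q)))ˣ, orderOf ζ = q := by
  refine exists_prime_orderOf_dvd_card' q ?_
  rw [Nat.card_units, GaloisField.card p _ (orderOf_natCast_pos hne).ne',
    ← ZMod.natCast_eq_zero_iff, Nat.cast_sub (Nat.one_le_pow _ _ (Fact.out : p.Prime).pos)]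
  push_cast
  rw [pow_orderOf_eq_one, sub_self]

theorem nu_mul_orderOf_le_finrank (hq : Odd q) {V : Type*} [AddCommGroup V]
    [Module (ZMod p) V] [Module.Finite (ZMod p) V] {b : LinearMap.BilinForm (ZMod p) V}
    {f : V ≃ₗ[ZMod p] V} (h : IsOrthogonalPair q b f) :
    nu (orderOf (p : ZMod q)) * orderOf (p : ZMod q) ≤ finrank (ZMod p) V := by
  have := h.nontrivial
  have hpos : 0 < finrank (ZMod p) V := finrank_pos
  have h1 := cast_pow_finrank_eq_one h.pow_eq_one h.eq_zero_of_apply_eq ⊤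
    fun x _ => Submodule.mem_top
  rw [finrank_top] at h1
  have h2 := orderOf_dvd_of_pow_eq_one h1
  have h3 := even_finrank_of_isometry hq h.symm h.nondegenerate h.pow_eq_one h.mem
    h.eq_zero_of_apply_eq
  rw [nu]
  split_ifs with hk
  · rw [one_mul]
    exact Nat.le_of_dvd hpos h2
  · exact Nat.le_of_dvd hpos (Nat.Coprime.mul_dvd_of_dvd_of_dvd
      (Nat.coprime_two_left.2 (Nat.not_even_iff_odd.1 hk)) h3.two_dvd h2)

theorem exists_isOrthogonalPair (hne : p ≠ q) :
    ∃ (V : Type u) (_ : AddCommGroup V) (_ : Module (ZMod p) V)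
      (_ : Module.Finite (ZMod p) V) (b : LinearMap.BilinForm (ZMod p) V)
      (f : V ≃ₗ[ZMod p] V), IsOrthogonalPair q b f ∧
        finrank (ZMod p) V = nu (orderOf (p : ZMod q)) * orderOf (p : ZMod q) := by
  obtain ⟨ζ, hζ⟩ := exists_unit_orderOf_eq hne
  have hpos := orderOf_natCast_pos hne
  have hfin := GaloisField.finrank p hpos.ne'
  rw [nu]
  split_ifs with hk
  · obtain ⟨m, hm⟩ := hk.two_dvd
    -- This gives `ζ ^ (p ^ m + 1) = 1`, the isometry condition for the twisted trace form.
    have h1 : q ∣ p ^ m + 1 := by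
      rw [← ZMod.natCast_eq_zero_iff]
      push_cast
      rw [pow_eq_neg_one_of_orderOf_eq hne hm, neg_add_cancel]
    obtain ⟨b, f, h⟩ := exists_orthogonalPair_even hpos.ne' hζ hm
      (by rwa [← pow_succ, ← orderOf_dvd_iff_pow_eq_one, hζ])
    -- `ULift` carries the example to the arbitrary universe `u`.
    refine ⟨ULift.{u} (GaloisField p (orderOf (p : ZMod q))), inferInstance, inferInstance,
      inferInstance, _, _, h.transport ULift.moduleEquiv.symm, ?_⟩
    rw [ULift.moduleEquiv.finrank_eq, hfin, one_mul]
  · obtain ⟨b, f, h⟩ := exists_orthogonalPair_hyperbolic hζ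
    refine ⟨ULift.{u} (GaloisField p (orderOf (p : ZMod q)) ×
      GaloisField p (orderOf (p : ZMod q))), inferInstance, inferInstance,
      inferInstance, _, _, h.transport ULift.moduleEquiv.symm, ?_⟩
    rw [ULift.moduleEquiv.finrank_eq, finrank_prod, hfin, two_mul]

end lagrangian

/-! ### Assembly of the minimal dimension and the four cases. -/

theorem mainTheorem4 (p₁ p : ℕ) [Fact p₁.Prime] [Fact p.Prime] (hp₁ : Odd p₁) (hne : p ≠ p₁)
    (k : ℕ) (hk : k = orderOf (p : ZMod p₁)) :
    IsLeast {n : ℕ | ∃ (V : Type u) (_ : AddCommGroup V) (_ : Module (ZMod p) V)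
        (_ : Module.Finite (ZMod p) V) (b : LinearMap.BilinForm (ZMod p) V)
        (f : V ≃ₗ[ZMod p] V), IsOrthogonalPair p₁ b f ∧ Module.finrank (ZMod p) V = n}
      (nu k * k) ∧
    ∀ (V : Type u) [AddCommGroup V] [Module (ZMod p) V] [Module.Finite (ZMod p) V]
      (b : LinearMap.BilinForm (ZMod p) V) (f : V ≃ₗ[ZMod p] V),
      IsOrthogonalPair p₁ b f → Module.finrank (ZMod p) V = nu k * k →
      (Odd p → Odd k →
        HasTotallyIsotropic b k ∧ Nonempty (orthogonalGroup b ≃* GOPlus k p)) ∧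
      (Odd p → Even k →
        ¬ HasTotallyIsotropic b (k / 2) ∧ Nonempty (orthogonalGroup b ≃* GOMinus (k / 2) p)) ∧
      (p = 2 → Odd k →
        b.IsAlt ∧ Nonempty (orthogonalGroup b ≃* Matrix.symplecticGroup (Fin k) (ZMod 2))) ∧
      (p = 2 → Even k →
        b.IsAlt ∧
          Nonempty (orthogonalGroup b ≃* Matrix.symplecticGroup (Fin (k / 2)) (ZMod 2))) := by
  subst hk
  have hpos := orderOf_natCast_pos hne
  refine ⟨⟨exists_isOrthogonalPair hne, ?_⟩, ?_⟩
  · rintro n ⟨V, _, _, _, b, f, h, rfl⟩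
    exact nu_mul_orderOf_le_finrank hp₁ h
  intro V _ _ _ b f h hn
  have hodd : Odd (orderOf (p : ZMod p₁)) →
      Module.finrank (ZMod p) V = 2 * orderOf (p : ZMod p₁) := fun hk => by
    rw [hn, nu, if_neg (Nat.not_even_iff_odd.2 hk)]
  have heven : Even (orderOf (p : ZMod p₁)) →
      Module.finrank (ZMod p) V = 2 * (orderOf (p : ZMod p₁) / 2) := fun hk => by
    rw [hn, nu, if_pos hk, one_mul, Nat.two_mul_div_two_of_even hk]
  have hplus : ∀ m, Module.finrank (ZMod p) V = 2 * m →
      (∃ v : Fin m ⊕ Fin m → V, ∀ i j, b (v i) (v j) = gramPlus m p i j) →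
      Nonempty (orthogonalGroup b ≃* GOPlus m p) := by
    rintro m hm ⟨v, hv⟩
    obtain ⟨e, he⟩ := exists_linearEquiv_of_gram (K := ZMod p) (det_gramPlus_ne_zero (p := p) m)
      (by rw [hm]; simp [two_mul]) hv
    exact nonempty_orthogonalGroup_mulEquiv e he
  refine ⟨fun hp hk => ?_, fun hp hk => ?_, ?_⟩
  · have hti := hasTotallyIsotropic_of_odd_orderOf hp₁ hne hk h
    exact ⟨hti, hplus _ (hodd hk) (exists_gramPlus_of_hasTotallyIsotropic
      (hp.ne_two_of_dvd_nat dvd_rfl) _ h.symm h.nondegenerate (hodd hk) hti)⟩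
  · have hp2 : p ≠ 2 := hp.ne_two_of_dvd_nat dvd_rfl
    have hq2 : p₁ ≠ 2 := hp₁.ne_two_of_dvd_nat dvd_rfl
    obtain ⟨m, hm⟩ := hk.two_dvd
    have hm' : orderOf (p : ZMod p₁) / 2 = m := by omega
    have hne1 : (p : ZMod p₁) ≠ 1 := fun h1 => by
      rw [h1, orderOf_one] at hm
      omega
    have hfr := heven hk
    rw [hm'] at hfr ⊢
    have hti := not_hasTotallyIsotropic_of_isometry hq2 hp2 (by omega)
      (pow_eq_neg_one_of_orderOf_eq hne hm) hne1 h.symm h.nondegenerate h.pow_eq_one h.mem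
      h.eq_zero_of_apply_eq hfr
    refine ⟨hti, ?_⟩
    -- `gramMinus m` is indexed by `Fin (m - 1)`, which reduces to `Fin n` once `m` is a successor.
    obtain ⟨n, rfl⟩ : ∃ n, m = n + 1 := ⟨m - 1, by omega⟩
    obtain ⟨v, hv⟩ := exists_gramMinus hp2 n h.symm h.nondegenerate hfr hti
    obtain ⟨e, he⟩ := exists_linearEquiv_of_gram (K := ZMod p) (det_gramMinus_ne_zero hp2 (n + 1))
      (by rw [hfr]; simp; omega) hv
    exact nonempty_orthogonalGroup_mulEquiv e he
  · have hsymp : p = 2 → ∀ m, Module.finrank (ZMod p) V = 2 * m → b.IsAlt ∧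
        Nonempty (orthogonalGroup b ≃* Matrix.symplecticGroup (Fin m) (ZMod 2)) := by
      rintro rfl m hm
      have ha := isAlt_of_isometry h.symm h.mem h.bijective.2
      obtain ⟨ψ⟩ := hplus m hm (exists_gramPlus_of_isAlt m h.symm ha h.nondegenerate hm)
      obtain ⟨χ⟩ := nonempty_orthogonalGroup_mulEquiv_symplecticGroup m
      exact ⟨ha, ⟨ψ.trans χ⟩⟩
    exact ⟨fun hp hk => hsymp hp _ (hodd hk), fun hp hk => hsymp hp _ (heven hk)⟩
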